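/- Consider $N$ peers on an undirected network $H$. At time $0$ every peer knows exactly block $0$. Blocks $1,2,\ldots$ arrive at the times of a random point process on $(0,\infty)$, each at some peer, which knows it at once; each peer contacts neighbours in $H$ at the points of further point processes, and when $p$ contacts $q$, peer $q$ learns the lowest-numbered block known to $p$ but not to $q$, if there is one. Almost surely no two events (arrivals or contacts) are simultaneous, only finitely many events occur in bounded time, and infinitely many blocks arrive. Let $G_p(t)$ be the directed graph on the set $B_p(t)$ of blocks known to $p$ at time $t$, with the references between them as edges. Under the tree policy, a block that arrives at peer $p$ at time $t$ gets exactly one outgoing reference, chosen once and for all: to the least indexed block among those of $G_p(t^-)$ with the largest hop distance to block $0$. Let $G(\infty)=\bigcup_{t\ge 0}\bigcup_p G_p(t)$. Suppose the arrival and gossip dynamics form a Markov process: there is a time-homogeneous continuous-time Markov process $X$ on a countable state space, with right-continuous paths and an arbitrary initial distribution, such that $X(t)$ determines at every time $t$ the dissemination state of the system, that is, for each block known to some but not all peers, in increasing order of index, the set of peers that know it. If $X$ is positive recurrent (every state is absorbing or has finite mean return time), then almost surely $G(\infty)$ is one-ended. Here an infinite path of a directed graph is a sequence of vertices $(v_k)$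 with $(v_k,v_{k+1})$ an edge for all $k$, or $(v_{k+1},v_k)$ an edge for all $k$; two infinite paths are equivalent if some infinite path meets each of them in infinitely many vertices; and an infinite directed graph is one-ended if it has an infinite path and all its infinite paths are equivalent. -/

import Mathlib

open MeasureTheory ProbabilityTheory Filter Topology
open scoped NNReal ENNReal

namespace Blockchain

/-! ### Directed graphs on blocks, infinite paths and ends -/

/-- A directed graph whose vertices are blocks (natural numbers); `Adj j k` is a reference from
block `j` to block `k`. -/
@[ext]
structure BlockGraph where
  verts : Set ℕ
  Adj : ℕ → ℕ → Prop
  left_mem : ∀ j k, Adj j k → j ∈ verts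
  right_mem : ∀ j k, Adj j k → k ∈ verts

namespace BlockGraph

/-- Union of a family of graphs (union of vertex sets, union of edge sets). -/
def iUnion {ι : Type*} (G : ι → BlockGraph) : BlockGraph where
  verts := ⋃ i, (G i).verts
  Adj j k := ∃ i, (G i).Adj j k
  left_mem := by
    rintro j k ⟨i, h⟩
    exact Set.mem_iUnion.2 ⟨i, (G i).left_mem j k h⟩
  right_mem := by
    rintro j k ⟨i, h⟩
    exact Set.mem_iUnion.2 ⟨i, (G i).right_mem j k h⟩

/-- The hop distance from `j` to `k`: the least number of edges of a directed path. -/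
noncomputable def hopDist (G : BlockGraph) (j k : ℕ) : ℕ :=
  sInf {n | ∃ v : ℕ → ℕ, v 0 = j ∧ v n = k ∧ ∀ i < n, G.Adj (v i) (v (i + 1))}

/-- The set of vertices that are farthest away from block `0`. -/
def farthest (G : BlockGraph) : Set ℕ :=
  {j | j ∈ G.verts ∧ ∀ j' ∈ G.verts, G.hopDist j' 0 ≤ G.hopDist j 0}

/-- An infinite path follows the edges forward at every step or backward at every step. -/
def IsInfinitePath (G : BlockGraph) (v : ℕ → ℕ) : Prop :=
  (∀ i, G.Adj (v i) (v (i + 1))) ∨ (∀ i, G.Adj (v (i + 1)) (v i))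

/-- Two infinite paths are equivalent if some infinite path meets both in infinitely many
vertices. -/
def PathEquiv (G : BlockGraph) (p₁ p₂ : ℕ → ℕ) : Prop :=
  ∃ p₃, G.IsInfinitePath p₃ ∧ (Set.range p₃ ∩ Set.range p₁).Infinite ∧
    (Set.range p₃ ∩ Set.range p₂).Infinite

/-- Exactly one end: the graph is infinite, it has an infinite path, and all its infinite paths
are equivalent. -/
def OneEnded (G : BlockGraph) : Prop :=
  G.verts.Infinite ∧ (∃ p, G.IsInfinitePath p) ∧
    ∀ p₁ p₂, G.IsInfinitePath p₁ → G.IsInfinitePath p₂ → G.PathEquiv p₁ p₂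

end BlockGraph

/-! ### Evolution of the system along a realization of arrivals and contacts -/

/-- An event: a new block arrives at (is mined by) peer `p`, or peer `p` contacts peer `q`. -/
inductive Event (N : ℕ) where
  | arrival (p : Fin N) : Event N
  | contact (p q : Fin N) : Event N

/-- State of the system: the number of blocks that have arrived so far (they are
`1, …, numArrived`), the block set of each peer, and the set of outgoing references of each
block. -/
structure Config (N : ℕ) where
  numArrived : ℕ
  known : Fin N → Finset ℕ
  refs : ℕ → Finset ℕ

namespace Config

variable {N : ℕ}

/-- At time `0` every peer knows exactly block `0`, which has no references. -/
def init (N : ℕ) : Config N where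
  numArrived := 0
  known := fun _ => {0}
  refs := fun _ => ∅

/-- The graph of peer `p`: the blocks known to `p` with the references between them. -/
def peerGraph (c : Config N) (p : Fin N) : BlockGraph where
  verts := ↑(c.known p)
  Adj j k := j ∈ c.known p ∧ k ∈ c.known p ∧ k ∈ c.refs j
  left_mem := fun _ _ h => h.1
  right_mem := fun _ _ h => h.2.1

/-- The block set of `q` after a contact from `p`: it gains the lowest numbered block that `p`
knows and `q` does not know, if there is one. -/
def received (c : Config N) (p q : Fin N) : Finset ℕ :=
  if h : (c.known p \ c.known q).Nonempty then
    insert ((c.known p \ c.known q).min' h) (c.known q)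
  else c.known q

/-- One step of the system. An arriving block takes the next index, its references are chosen
from the graph of the mining peer just before the arrival, and it is known to that peer at
once. -/
def step (policy : BlockGraph → Finset ℕ) (c : Config N) : Event N → Config N
  | .arrival p =>
    { numArrived := c.numArrived + 1
      known := Function.update c.known p (insert (c.numArrived + 1) (c.known p))
      refs := Function.update c.refs (c.numArrived + 1) (policy (c.peerGraph p)) }
  | .contact p q =>
    { c with known := Function.update c.known q (c.received p q) }

/-- The configuration after the first `n` events of the sequence `e`. -/
def after (policy : BlockGraph → Finset ℕ) (e : ℕ → Event N) : ℕ → Config N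
  | 0 => init N
  | n + 1 => (after policy e n).step policy (e n)

/-- The blocks that are known to some peer but not to all peers. -/
def pending (c : Config N) : Finset ℕ :=
  (Finset.univ.biUnion c.known).filter fun b => ∃ p, b ∉ c.known p

/-- The dissemination state: for every block that is not yet known to all peers, in increasing
order of index, the set of peers that know it. -/
def backlog (c : Config N) : List (Finset (Fin N)) :=
  (c.pending.sort (· ≤ ·)).map fun b => Finset.univ.filter fun p => b ∈ c.known p

end Config

/-- The tree policy: a single reference, to the least indexed block among those that are farthest
from block `0`. -/
noncomputable def treePolicy (G : BlockGraph) : Finset ℕ := {sInf G.farthest}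

/-- `τ` and `e` are the times and the marks of the superposition of the arrival process and the
contact processes of the peers: event times are positive, no two events are simultaneous, only
finitely many occur in bounded time, infinitely many blocks arrive, and peers contact only their
neighbours in the network `H`. -/
structure IsRealization {N : ℕ} (H : SimpleGraph (Fin N)) (τ : ℕ → ℝ≥0) (e : ℕ → Event N) :
    Prop where
  pos : ∀ n, 0 < τ n
  strictMono : StrictMono τ
  tendsto : Tendsto τ atTop atTop
  arrivals : {n | ∃ p, e n = Event.arrival p}.Infinite
  contacts : ∀ n p q, e n = Event.contact p q → H.Adj p q

/-- The configuration at time `t`: all events at times `≤ t` have been carried out. -/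
noncomputable def configAt {N : ℕ} (policy : BlockGraph → Finset ℕ) (τ : ℕ → ℝ≥0)
    (e : ℕ → Event N) (t : ℝ≥0) : Config N :=
  Config.after policy e {n | τ n ≤ t}.ncard

/-- `G(t)`, the union of the graphs of all peers at all times `s ≤ t`. -/
noncomputable def graphAt {N : ℕ} (policy : BlockGraph → Finset ℕ) (τ : ℕ → ℝ≥0)
    (e : ℕ → Event N) (t : ℝ≥0) : BlockGraph :=
  BlockGraph.iUnion fun s : Set.Iic t =>
    BlockGraph.iUnion fun p : Fin N => (configAt policy τ e s).peerGraph p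

/-- The limiting graph `G(∞)`, the union of all `G(t)`. -/
noncomputable def limitGraph {N : ℕ} (policy : BlockGraph → Finset ℕ) (τ : ℕ → ℝ≥0)
    (e : ℕ → Event N) : BlockGraph :=
  BlockGraph.iUnion fun t : ℝ≥0 => graphAt policy τ e t

/-! ### Continuous-time Markov chains on a countable state space -/

section Markov

variable {S Ω : Type*} [MeasurableSpace S] [MeasurableSpace Ω]

/-- `X` is a time-homogeneous continuous-time Markov process on the discrete space `S`, with
right-continuous paths; `P x` is its law when it starts in `x`. The Markov property is the
one with respect to the natural filtration of `X`. -/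
structure IsMarkovProcess (P : Kernel S Ω) (X : ℝ≥0 → Ω → S) : Prop where
  measurable : ∀ t, Measurable (X t)
  rightContinuous : ∀ ω t, ∀ᶠ u in 𝓝[≥] t, X u ω = X t ω
  initial : ∀ x, ∀ᵐ ω ∂(P x), X 0 ω = x
  markov : ∀ (x : S) (s t : ℝ≥0) (y : S) (A : Set Ω),
    MeasurableSet[⨆ u : Set.Iic s, MeasurableSpace.comap (X u) inferInstance] A →
      P x (A ∩ {ω | X (s + t) ω = y}) = ∫⁻ ω in A, P (X s ω) {ω' | X t ω' = y} ∂(P x)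

/-- The first time at which the path is in `x` after having been outside `x` (`∞` if there is no
such time). -/
noncomputable def returnTime (X : ℝ≥0 → Ω → S) (x : S) (ω : Ω) : ℝ≥0∞ :=
  ⨅ (t : ℝ≥0) (_ : X t ω = x ∧ ∃ s < t, X s ω ≠ x), (t : ℝ≥0∞)

/-- Every state is positive recurrent: it is absorbing, or the mean return time to it is
finite. -/
def PositiveRecurrent (P : Kernel S Ω) (X : ℝ≥0 → Ω → S) : Prop :=
  ∀ x, (∀ᵐ ω ∂(P x), ∀ t, X t ω = x) ∨ ∫⁻ ω, returnTime X x ω ∂(P x) < ∞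

end Markov

end Blockchain

/-! At time `0` every block is known to every peer, so the backlog is empty. The state of `X`
determines the backlog, and `X` almost surely revisits its initial state at arbitrarily late times;
at each such time all blocks are again known to all peers. This is the only use of probability.

Suppose that this happens when blocks `0, …, m` have arrived, and let `b` be the least indexed
deepest of them. A later block references `b` if its miner knows nothing newer. Otherwise the miner
knows a newer block, inductively a descendant of `b` and so deeper than all of `0, …, m`, and the
reference goes to a newer block. Hence `b` is an ancestor of every later block
(`isAncestor_of_known`). Such cut vertices occur with arbitrarily large index, and every infinite
path passes through all of them from its start on, so there is one end
(`oneEnded_of_frequently_cut`).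

Recurrence is proved without a strong Markov property. A finite mean return time makes a return
almost sure, and the Markov property at a countable dense set of times makes a further return almost
sure from each such time spent in `x`. If the visits to `x` still ended at a finite supremum `L`,
entries into `x` would accumulate at `L`. That is excluded by `ae_no_accumulation`: each entry seen
on a time grid is followed by a stay of length `δ` with a fixed positive probability, and at most
one entry in a window of length `δ` can be, so the mean number of entries is bounded uniformly in
the mesh, and Fatou's lemma applies. -/

namespace Blockchain

/-! ### Rooted trees given by a parent function -/

section Tree

variable {par : ℕ → ℕ}

/-- `a` is an ancestor of `j` (or `j` itself) for the parent function `par`. -/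
def IsAncestor (par : ℕ → ℕ) (a j : ℕ) : Prop := ∃ n, par^[n] j = a

theorem IsAncestor.refl (j : ℕ) : IsAncestor par j j := ⟨0, rfl⟩

theorem IsAncestor.trans {a b j : ℕ} (h : IsAncestor par a b) (h' : IsAncestor par b j) :
    IsAncestor par a j := by
  obtain ⟨n, rfl⟩ := h
  obtain ⟨m, rfl⟩ := h'
  exact ⟨n + m, Function.iterate_add_apply _ _ _ _⟩

theorem IsAncestor.of_parent {a j : ℕ} (h : IsAncestor par a (par j)) : IsAncestor par a j :=
  h.trans ⟨1, rfl⟩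

/-- The number of generations between `j` and the root `0`. -/
noncomputable def depth (par : ℕ → ℕ) (j : ℕ) : ℕ := sInf {n | par^[n] j = 0}

theorem iterate_parent_le (hlt : ∀ j, j ≠ 0 → par j < j) (h0 : par 0 = 0) (n j : ℕ) :
    par^[n] j ≤ j := by
  induction n generalizing j with
  | zero => simp
  | succ n ih =>
    rw [Function.iterate_succ_apply]
    refine (ih _).trans ?_
    rcases eq_or_ne j 0 with rfl | hj
    · exact h0.le
    · exact (hlt j hj).le

theorem isAncestor_zero (hlt : ∀ j, j ≠ 0 → par j < j) (j : ℕ) : IsAncestor par 0 j := by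
  induction j using Nat.strong_induction_on with
  | _ j ih =>
    rcases eq_or_ne j 0 with rfl | hj
    · exact .refl 0
    · exact (ih _ (hlt j hj)).of_parent

theorem depth_eq_succ (hlt : ∀ j, j ≠ 0 → par j < j) {j : ℕ} (hj : j ≠ 0) :
    depth par j = depth par (par j) + 1 := by
  have hne : {n | par^[n] j = 0}.Nonempty := isAncestor_zero hlt j
  have h1 : 1 ≤ sInf {n | par^[n] j = 0} := by
    rw [Nat.one_le_iff_ne_zero]
    intro h
    have := Nat.sInf_mem hne
    rw [h] at this
    exact hj this
  have := Nat.sInf_add (n := 1) (p := fun n => par^[n] j = 0) h1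
  exact this.symm

theorem depth_le_of_isAncestor (hlt : ∀ j, j ≠ 0 → par j < j) (h0 : par 0 = 0) {a j : ℕ}
    (h : IsAncestor par a j) : depth par a ≤ depth par j := by
  obtain ⟨n, rfl⟩ := h
  induction n generalizing j with
  | zero => rfl
  | succ n ih =>
    rw [Function.iterate_succ_apply]
    refine ih.trans ?_
    rcases eq_or_ne j 0 with rfl | hj
    · rw [h0]
    · rw [depth_eq_succ hlt hj]; omega

theorem depth_lt_of_isAncestor (hlt : ∀ j, j ≠ 0 → par j < j) (h0 : par 0 = 0) {a j : ℕ}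
    (h : IsAncestor par a j) (hne : a ≠ j) : depth par a < depth par j := by
  obtain ⟨n, rfl⟩ := h
  cases n with
  | zero => exact absurd rfl hne
  | succ n =>
    have hj : j ≠ 0 := by
      rintro rfl
      exact hne (Nat.le_zero.1 (iterate_parent_le hlt h0 _ _))
    have := depth_le_of_isAncestor hlt h0 (a := par^[n] (par j)) (j := par j) ⟨n, rfl⟩
    rw [Function.iterate_succ_apply, depth_eq_succ hlt hj]
    omega

/-- Of two ancestors of the same vertex, the one with the smaller index is an ancestor of the
other. -/
theorem IsAncestor.of_le (hlt : ∀ j, j ≠ 0 → par j < j) (h0 : par 0 = 0) {a b j : ℕ}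
    (ha : IsAncestor par a j) (hb : IsAncestor par b j) (hab : a ≤ b) : IsAncestor par a b := by
  obtain ⟨n, rfl⟩ := ha
  obtain ⟨m, rfl⟩ := hb
  rcases le_total m n with h | h
  · exact ⟨n - m, by rw [← Function.iterate_add_apply, Nat.sub_add_cancel h]⟩
  · have : par^[m] j ≤ par^[n] j := by
      rw [← Nat.sub_add_cancel h, Function.iterate_add_apply]
      exact iterate_parent_le hlt h0 _ _
    rw [le_antisymm hab this]
    exact .refl _

/-- Between a vertex and a proper ancestor there is a child of the ancestor. -/
theorem IsAncestor.exists_child (h0 : par 0 = 0) {a b : ℕ} (h : IsAncestor par a b)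
    (hne : a ≠ b) : ∃ a', a' ≠ 0 ∧ par a' = a ∧ IsAncestor par a' b := by
  classical
  have hmin := Nat.find_spec h
  rcases hk : Nat.find h with _ | k
  · rw [hk] at hmin
    exact absurd hmin.symm hne
  · rw [hk, Function.iterate_succ_apply'] at hmin
    refine ⟨par^[k] b, fun hz => ?_, hmin, k, rfl⟩
    refine Nat.find_min h (m := k) (by omega) ?_
    rw [← hmin, hz, h0]

/-- A tree with infinitely many vertices that are ancestors of all but finitely many vertices is
one-ended. -/
theorem oneEnded_of_frequently_cut (hlt : ∀ j, j ≠ 0 → par j < j) (h0 : par 0 = 0)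
    {G : BlockGraph} (hG : ∀ j k, G.Adj j k ↔ j ≠ 0 ∧ k = par j)
    (hcut : ∀ M, ∃ b ≥ M, ∀ᶠ j in atTop, IsAncestor par b j) : G.OneEnded := by
  have hback : ∀ v, G.IsInfinitePath v → ∀ i, v (i + 1) ≠ 0 ∧ v i = par (v (i + 1)) := by
    rintro v (hv | hv)
    · exfalso
      -- A forward path moves to parents, so its index drops at every step, which cannot go on
      -- forever.
      have hd : ∀ i, v i + i ≤ v 0 := by
        intro i
        induction i with
        | zero => simp
        | succ i ih =>
          obtain ⟨h1, h2⟩ := (hG _ _).1 (hv i)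
          have := hlt _ h1
          omega
      have := hd (v 0 + 1)
      omega
    · exact fun i => (hG _ _).1 (hv i)
  have hmono : ∀ v, G.IsInfinitePath v → StrictMono v := fun v hv =>
    strictMono_nat_of_lt_succ fun i => by
      obtain ⟨h1, h2⟩ := hback v hv i
      rw [h2]
      exact hlt _ h1
  have hmem : ∀ v, G.IsInfinitePath v → ∀ b ≥ v 0, (∀ᶠ j in atTop, IsAncestor par b j) →
      b ∈ Set.range v := by
    intro v hv b hb hcut
    -- A late vertex of the path descends from `b`. Its ancestor chain retraces `v` and must meet
    -- `b` before passing `v 0`, because `b ≥ v 0`.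
    obtain ⟨i, n, hn⟩ := ((hmono v hv).tendsto_atTop.eventually hcut).exists
    induction i generalizing n with
    | zero =>
      have := iterate_parent_le hlt h0 n (v 0)
      exact ⟨0, by omega⟩
    | succ i ih =>
      cases n with
      | zero => exact ⟨i + 1, hn⟩
      | succ n =>
        rw [Function.iterate_succ_apply, ← (hback v hv i).2] at hn
        exact ih n hn
  refine ⟨?_, ?_, ?_⟩
  · refine Set.infinite_of_not_bddAbove ?_
    rintro ⟨M, hM⟩
    have := hM (G.left_mem _ _ ((hG (M + 1) _).2 ⟨by omega, rfl⟩))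
    omega
  -- The child of a cut vertex that lies on the way to a later cut vertex is itself a cut vertex;
  -- iterating this from the root gives an infinite path.
  · have hchild : ∀ a : {a // ∀ᶠ j in atTop, IsAncestor par a j},
        ∃ a' : {a // ∀ᶠ j in atTop, IsAncestor par a j}, a'.1 ≠ 0 ∧ par a' = a := by
      rintro ⟨a, ha⟩
      obtain ⟨b, hb, hbc⟩ := hcut (a + 1)
      obtain ⟨j, hj1, hj2⟩ := (ha.and hbc).exists
      obtain ⟨a', h1, h2, h3⟩ :=
        (hj1.of_le hlt h0 hj2 (by omega)).exists_child h0 (by omega)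
      exact ⟨⟨a', hbc.mono fun j hj => h3.trans hj⟩, h1, h2⟩
    choose g hg using hchild
    refine ⟨fun n => (g^[n] ⟨0, .of_forall (isAncestor_zero hlt)⟩).1, .inr fun i => ?_⟩
    rw [hG]
    simp only [Function.iterate_succ_apply']
    exact ⟨(hg _).1, (hg _).2.symm⟩
  · intro v w hv hw
    refine ⟨v, hv, ?_, ?_⟩
    · rw [Set.inter_self]
      exact Set.infinite_range_of_injective (hmono v hv).injective
    · refine Set.infinite_of_not_bddAbove ?_
      rintro ⟨M, hM⟩
      obtain ⟨b, hb, hbc⟩ := hcut (max (M + 1) (max (v 0) (w 0)))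
      have := hM ⟨hmem v hv b (by omega) hbc, hmem w hw b (by omega) hbc⟩
      omega

/-- The members of `K` of largest depth. -/
def deepest (par : ℕ → ℕ) (K : Finset ℕ) : Set ℕ :=
  {i | i ∈ K ∧ ∀ i' ∈ K, depth par i' ≤ depth par i}

theorem sInf_deepest_mem {K : Finset ℕ} (hK : K.Nonempty) :
    sInf (deepest par K) ∈ deepest par K :=
  Nat.sInf_mem (K.exists_max_image (depth par) hK)

/-- If each vertex `j` is attached to the least indexed deepest vertex of a set `K j`, and if
all the sets `K j` with `j > m` contain `{0, …, m}`, then the least indexed deepest vertex of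
`{0, …, m}` is an ancestor of all later vertices. -/
theorem isAncestor_of_known (hlt : ∀ j, j ≠ 0 → par j < j) (h0 : par 0 = 0)
    {K : ℕ → Finset ℕ} (hK : ∀ j, j ≠ 0 → K j ⊆ Finset.range j)
    (hpar : ∀ j, j ≠ 0 → par j = sInf (deepest par (K j))) {m : ℕ}
    (hm : ∀ j > m, Finset.range (m + 1) ⊆ K j) (j : ℕ) (hj : m < j) :
    IsAncestor par (sInf (deepest par (Finset.range (m + 1)))) j := by
  obtain ⟨hb, hmax⟩ := sInf_deepest_mem (par := par) (K := Finset.range (m + 1)) ⟨0, by simp⟩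
  induction j using Nat.strong_induction_on with
  | _ j ih =>
    have hj0 : j ≠ 0 := by omega
    by_cases hKj : K j = Finset.range (m + 1)
    · exact ⟨1, by rw [Function.iterate_one, hpar j hj0, hKj]⟩
    · obtain ⟨i, hi, him⟩ : ∃ i ∈ K j, i ∉ Finset.range (m + 1) :=
        Finset.not_subset.1 fun h => hKj (h.antisymm (hm j hj))
      obtain ⟨hk, hkmax⟩ := sInf_deepest_mem (par := par) (K := K j) ⟨i, hi⟩
      rw [← hpar j hj0] at hk hkmax
      refine (ih _ (hlt j hj0) ?_).of_parent
      rw [Finset.mem_range] at him hb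
      have hij := Finset.mem_range.1 (hK j hj0 hi)
      -- The known block `i > m` lies strictly below the deepest vertex of `{0, …, m}`, so `par j`,
      -- at least as deep as `i`, cannot have index at most `m`.
      have h1 := depth_lt_of_isAncestor hlt h0 (ih i hij (by omega)) (by omega)
      have h2 := hkmax i hi
      by_contra hle
      have h3 := hmax (par j) (Finset.mem_range.2 (by omega))
      omega

/-- Block `m + 1` is strictly deeper than everything in `{0, …, m}`, so the deepest vertex at a
later synchronization `m' ≥ m + 1` has index above `m`. Cut vertices are therefore unbounded. -/
theorem frequently_cut_of_known (hlt : ∀ j, j ≠ 0 → par j < j) (h0 : par 0 = 0)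
    {K : ℕ → Finset ℕ} (hK : ∀ j, j ≠ 0 → K j ⊆ Finset.range j)
    (hpar : ∀ j, j ≠ 0 → par j = sInf (deepest par (K j)))
    (hsync : ∀ M, ∃ m ≥ M, ∀ j > m, Finset.range (m + 1) ⊆ K j) (M : ℕ) :
    ∃ b ≥ M, ∀ᶠ j in atTop, IsAncestor par b j := by
  obtain ⟨m, hmM, hm⟩ := hsync M
  obtain ⟨m', hmm', hm'⟩ := hsync (m + 1)
  refine ⟨_, ?_, (eventually_gt_atTop m').mono (isAncestor_of_known hlt h0 hK hpar hm')⟩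
  obtain ⟨hb, hmax⟩ := sInf_deepest_mem (par := par) (K := Finset.range (m + 1)) ⟨0, by simp⟩
  obtain ⟨-, hmax'⟩ := sInf_deepest_mem (par := par) (K := Finset.range (m' + 1)) ⟨0, by simp⟩
  rw [Finset.mem_range] at hb
  have h1 := depth_lt_of_isAncestor hlt h0
    (isAncestor_of_known hlt h0 hK hpar hm (m + 1) (by omega)) (by omega)
  have h2 := hmax' (m + 1) (Finset.mem_range.2 (by omega))
  by_contra hlt'
  have h3 := hmax _ (Finset.mem_range.2 (lt_of_not_ge hlt' |>.trans_le (by omega)))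
  omega

end Tree

/-! ### The evolution under the tree policy -/

namespace Config

variable {N : ℕ} {par : ℕ → ℕ} {c : Config N}

theorem subset_received (c : Config N) (p q : Fin N) : c.known q ⊆ c.received p q := by
  unfold received
  split_ifs
  · exact Finset.subset_insert _ _
  · rfl

theorem known_subset_step (policy : BlockGraph → Finset ℕ) (c : Config N) (ev : Event N)
    (p : Fin N) : c.known p ⊆ (c.step policy ev).known p := by
  rcases ev with q | ⟨q, r⟩
  · rcases eq_or_ne p q with rfl | h
    · simp [step]
    · simp [step, h]
  · rcases eq_or_ne p r with rfl | h
    · simpa [step] using c.subset_received q p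
    · simp [step, h]

theorem numArrived_le_step (policy : BlockGraph → Finset ℕ) (c : Config N) (ev : Event N) :
    c.numArrived ≤ (c.step policy ev).numArrived := by
  rcases ev with q | ⟨q, r⟩ <;> simp [step]

theorem known_after_mono (policy : BlockGraph → Finset ℕ) (e : ℕ → Event N) (p : Fin N) :
    Monotone fun n => (after policy e n).known p :=
  monotone_nat_of_le_succ fun n => known_subset_step policy _ (e n) p

theorem numArrived_after_mono (policy : BlockGraph → Finset ℕ) (e : ℕ → Event N) :
    Monotone fun n => (after policy e n).numArrived :=
  monotone_nat_of_le_succ fun n => numArrived_le_step policy _ (e n)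

theorem numArrived_after_succ (policy : BlockGraph → Finset ℕ) {e : ℕ → Event N} {n : ℕ}
    {p : Fin N} (h : e n = .arrival p) :
    (after policy e (n + 1)).numArrived = (after policy e n).numArrived + 1 := by
  simp [after, h, step]

/-- Blocks carry the references prescribed by `par`, and the block sets of the peers are closed
under taking references. -/
structure IsTree (par : ℕ → ℕ) (c : Config N) : Prop where
  zero_mem : ∀ p, 0 ∈ c.known p
  le_numArrived : ∀ p, ∀ j ∈ c.known p, j ≤ c.numArrived
  exists_mem : ∀ j ≤ c.numArrived, ∃ p, j ∈ c.known p
  refs_zero : c.refs 0 = ∅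
  refs_eq : ∀ j ≠ 0, j ≤ c.numArrived → c.refs j = {par j}
  parent_lt : ∀ j ≠ 0, j ≤ c.numArrived → par j < j
  parent_mem : ∀ p, ∀ j ∈ c.known p, j ≠ 0 → par j ∈ c.known p

theorem IsTree.peerGraph_adj (h : c.IsTree par) (p : Fin N) (j k : ℕ) :
    (c.peerGraph p).Adj j k ↔ j ∈ c.known p ∧ j ≠ 0 ∧ k = par j := by
  constructor
  · rintro ⟨hj, hk, hr⟩
    have hj0 : j ≠ 0 := by
      rintro rfl
      simp [h.refs_zero] at hr
    rw [h.refs_eq j hj0 (h.le_numArrived p j hj), Finset.mem_singleton] at hr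
    exact ⟨hj, hj0, hr⟩
  · rintro ⟨hj, hj0, rfl⟩
    refine ⟨hj, h.parent_mem p j hj hj0, ?_⟩
    simp [h.refs_eq j hj0 (h.le_numArrived p j hj)]

/-- Each vertex has at most one outgoing edge, so a path from `j` can only follow parents; closure
of the block set under parents keeps that path inside the graph of the peer. Distances thus do not
depend on the peer. -/
theorem IsTree.hopDist_eq (h : c.IsTree par) (p : Fin N) {j : ℕ}
    (hj : j ∈ c.known p) : (c.peerGraph p).hopDist j 0 = depth par j := by
  have hsub : ∀ (n : ℕ) (v : ℕ → ℕ), v 0 = j → (∀ i < n, (c.peerGraph p).Adj (v i) (v (i + 1))) →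
      v n = par^[n] j := by
    intro n v hv0 hv
    induction n with
    | zero => exact hv0
    | succ n ih =>
      rw [Function.iterate_succ_apply', ← ih fun i hi => hv i (by omega)]
      exact ((h.peerGraph_adj p _ _).1 (hv n (by omega))).2.2
  have hpath : ∀ n, (∀ i < n, par^[i] j ≠ 0) →
      par^[n] j ∈ c.known p ∧ ∀ i < n, (c.peerGraph p).Adj (par^[i] j) (par^[i + 1] j) := by
    intro n
    induction n with
    | zero => exact fun _ => ⟨hj, by simp⟩
    | succ n ih =>
      intro hn
      obtain ⟨h1, h2⟩ := ih fun i hi => hn i (by omega)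
      have hadj : (c.peerGraph p).Adj (par^[n] j) (par^[n + 1] j) :=
        (h.peerGraph_adj p _ _).2
          ⟨h1, hn n (by omega), Function.iterate_succ_apply' _ _ _⟩
      refine ⟨hadj.2.1, fun i hi => ?_⟩
      rcases Nat.lt_succ_iff_lt_or_eq.1 hi with hi | rfl
      · exact h2 i hi
      · exact hadj
  unfold BlockGraph.hopDist depth
  have hle : {n | ∃ v : ℕ → ℕ, v 0 = j ∧ v n = 0 ∧
      ∀ i < n, (c.peerGraph p).Adj (v i) (v (i + 1))} ⊆ {n | par^[n] j = 0} := by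
    rintro n ⟨v, h0, hn, hv⟩
    rw [Set.mem_ofPred_eq, ← hsub n v h0 hv, hn]
  -- If no iterate reaches `0`, both infima are `sInf ∅ = 0`.
  rcases Set.eq_empty_or_nonempty {n | par^[n] j = 0} with he | hne
  · rw [he] at hle
    rw [he, Set.subset_empty_iff.1 hle]
  · have hmem : sInf {n | par^[n] j = 0} ∈ {n | ∃ v : ℕ → ℕ, v 0 = j ∧ v n = 0 ∧
        ∀ i < n, (c.peerGraph p).Adj (v i) (v (i + 1))} :=
      ⟨fun i => par^[i] j, rfl, Nat.sInf_mem hne,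
        (hpath _ fun i hi hz => Nat.notMem_of_lt_sInf hi hz).2⟩
    exact le_antisymm (Nat.sInf_le hmem) (Nat.sInf_le (hle (Nat.sInf_mem ⟨_, hmem⟩)))

theorem IsTree.farthest_eq (h : c.IsTree par) (p : Fin N) :
    (c.peerGraph p).farthest = deepest par (c.known p) := by
  have hverts : ∀ j, j ∈ (c.peerGraph p).verts ↔ j ∈ c.known p := fun j => Finset.mem_coe
  ext j
  simp only [BlockGraph.farthest, deepest, Set.mem_ofPred_eq, hverts]
  refine and_congr_right fun hj => forall₂_congr fun i hi => ?_
  rw [h.hopDist_eq p hi, h.hopDist_eq p hj]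

theorem IsTree.init (p₀ : Fin N) : (Config.init N).IsTree par where
  zero_mem p := by simp [Config.init]
  le_numArrived p j hj := by simpa [Config.init] using hj
  exists_mem j hj := ⟨p₀, by simpa [Config.init] using hj⟩
  refs_zero := rfl
  refs_eq j hj hle := absurd (Nat.le_zero.1 hle) hj
  parent_lt j hj hle := absurd (Nat.le_zero.1 hle) hj
  parent_mem p j hj h0 := absurd (by simpa [Config.init] using hj) h0

theorem IsTree.sInf_farthest_mem (h : c.IsTree par) (p : Fin N) :
    sInf (c.peerGraph p).farthest ∈ c.known p := by
  rw [h.farthest_eq p]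
  exact (sInf_deepest_mem ⟨0, h.zero_mem p⟩).1

theorem IsTree.step_arrival (h : c.IsTree par) (p : Fin N)
    (hpar : par (c.numArrived + 1) = sInf (c.peerGraph p).farthest) :
    (c.step treePolicy (.arrival p)).IsTree par := by
  have hmem := h.sInf_farthest_mem p
  have hlt := h.le_numArrived p _ hmem
  rw [← hpar] at hmem hlt
  have hknown : ∀ q j, j ∈ (c.step treePolicy (.arrival p)).known q ↔
      j ∈ c.known q ∨ q = p ∧ j = c.numArrived + 1 := by
    intro q j
    rcases eq_or_ne q p with rfl | hq
    · simp [step, or_comm]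
    · simp [step, hq]
  have hnum : (c.step treePolicy (.arrival p)).numArrived = c.numArrived + 1 := rfl
  have hrefs : ∀ j ≠ c.numArrived + 1, (c.step treePolicy (.arrival p)).refs j = c.refs j :=
    fun j hj => by simp [step, hj]
  have hrefs' : (c.step treePolicy (.arrival p)).refs (c.numArrived + 1) =
      {par (c.numArrived + 1)} := by simp [step, treePolicy, hpar]
  refine ⟨fun q => (hknown _ _).2 (.inl (h.zero_mem q)), ?_, ?_, ?_, ?_, ?_, ?_⟩
  · intro q j hj
    rw [hnum]
    rcases (hknown _ _).1 hj with hj | ⟨-, rfl⟩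
    · exact (h.le_numArrived q j hj).trans (Nat.le_succ _)
    · rfl
  · intro j hj
    rw [hnum] at hj
    rcases Nat.le_succ_iff.1 hj with hj | rfl
    · obtain ⟨q, hq⟩ := h.exists_mem j hj
      exact ⟨q, (hknown _ _).2 (.inl hq)⟩
    · exact ⟨p, (hknown _ _).2 (.inr ⟨rfl, rfl⟩)⟩
  · rw [hrefs 0 (by omega), h.refs_zero]
  · intro j hj0 hj
    rw [hnum] at hj
    rcases Nat.le_succ_iff.1 hj with hj | rfl
    · rw [hrefs j (by omega), h.refs_eq j hj0 hj]
    · exact hrefs'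
  · intro j hj0 hj
    rw [hnum] at hj
    rcases Nat.le_succ_iff.1 hj with hj | rfl
    · exact h.parent_lt j hj0 hj
    · show par (c.numArrived + 1) < c.numArrived + 1
      omega
  · intro q j hj hj0
    rw [hknown]
    rcases (hknown _ _).1 hj with hj | ⟨rfl, rfl⟩
    · exact .inl (h.parent_mem q j hj hj0)
    · exact .inl hmem

/-- Sending the lowest missing block preserves closure under parents: the parent has a smaller index
and is known to the sender, so the receiver already has it. -/
theorem IsTree.step_contact (h : c.IsTree par) (p q : Fin N) :
    (c.step treePolicy (.contact p q)).IsTree par := by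
  have hsub := known_subset_step treePolicy c (.contact p q)
  have hknown : ∀ r j, j ∈ (c.step treePolicy (.contact p q)).known r → j ∈ c.known r ∨
      r = q ∧ j ∈ c.known p ∧ ∀ i ∈ c.known p, i < j → i ∈ c.known q := by
    intro r j hj
    rcases eq_or_ne r q with rfl | hr
    · simp only [step, Function.update_self, received] at hj
      split_ifs at hj with hne
      · rcases Finset.mem_insert.1 hj with rfl | hj
        · refine .inr ⟨rfl, (Finset.mem_sdiff.1 (Finset.min'_mem _ hne)).1, fun i hi hlt => ?_⟩
          by_contra hi'
          exact hlt.not_ge (Finset.min'_le _ _ (Finset.mem_sdiff.2 ⟨hi, hi'⟩))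
        · exact .inl hj
      · exact .inl hj
    · simp only [step, Function.update_of_ne hr] at hj
      exact .inl hj
  refine ⟨fun r => hsub r (h.zero_mem r), ?_, ?_, h.refs_zero, h.refs_eq, h.parent_lt, ?_⟩
  · intro r j hj
    rcases hknown r j hj with hj | ⟨-, hj, -⟩
    · exact h.le_numArrived r j hj
    · exact h.le_numArrived p j hj
  · intro j hj
    obtain ⟨r, hr⟩ := h.exists_mem j hj
    exact ⟨r, hsub r hr⟩
  · intro r j hj hj0
    rcases hknown r j hj with hj | ⟨rfl, hj, hmin⟩
    · exact hsub r (h.parent_mem r j hj hj0)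
    · exact hsub r (hmin _ (h.parent_mem p j hj hj0)
        (h.parent_lt j hj0 (h.le_numArrived p j hj)))

theorem IsTree.after (p₀ : Fin N) {e : ℕ → Event N}
    (hpar : ∀ n p, e n = .arrival p → par ((Config.after treePolicy e n).numArrived + 1) =
      sInf ((Config.after treePolicy e n).peerGraph p).farthest) (n : ℕ) :
    (Config.after treePolicy e n).IsTree par := by
  induction n with
  | zero => exact .init p₀
  | succ n ih =>
    rw [Config.after]
    rcases hev : e n with p | ⟨p, q⟩
    · exact ih.step_arrival p (hpar n p hev)
    · exact ih.step_contact p q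

theorem IsTree.range_subset_of_backlog (h : c.IsTree par) (hb : c.backlog = []) (p : Fin N) :
    Finset.range (c.numArrived + 1) ⊆ c.known p := by
  intro j hj
  obtain ⟨q, hq⟩ := h.exists_mem j (by simpa [Nat.lt_succ_iff] using hj)
  by_contra hp
  have hmem : j ∈ c.pending := by
    simp only [pending, Finset.mem_filter, Finset.mem_biUnion, Finset.mem_univ, true_and]
    exact ⟨⟨q, hq⟩, p, hp⟩
  have hb' : c.pending.sort (· ≤ ·) = [] := List.map_eq_nil_iff.1 hb
  rw [← Finset.mem_sort (· ≤ ·), hb'] at hmem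
  simp at hmem

theorem backlog_init (N : ℕ) : (init N).backlog = [] := by
  have : (init N).pending = ∅ := by
    ext j
    simp only [pending, init, Finset.mem_filter, Finset.mem_biUnion, Finset.mem_univ, true_and,
      Finset.mem_singleton, Finset.notMem_empty, iff_false]
    rintro ⟨⟨-, h⟩, -, h'⟩
    exact h' h
  simp [backlog, this]

/-- For every `j` there is an arrival that happens when exactly `j` blocks have arrived. -/
theorem exists_arrival (policy : BlockGraph → Finset ℕ) {e : ℕ → Event N}
    (harr : {n | ∃ p, e n = Event.arrival p}.Infinite) (j : ℕ) :
    ∃ n p, e n = .arrival p ∧ (after policy e n).numArrived = j := by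
  induction j with
  | zero =>
    classical
    have hex := harr.nonempty
    obtain ⟨p, hp⟩ := Nat.find_spec hex
    refine ⟨_, p, hp, ?_⟩
    have : ∀ m ≤ Nat.find hex, (after policy e m).numArrived = 0 := by
      intro m hm
      induction m with
      | zero => rfl
      | succ m ih =>
        rcases hev : e m with q | ⟨q, r⟩
        · exact absurd ⟨q, hev⟩ (Nat.find_min hex (m := m) (by omega))
        · simpa [after, hev, step] using ih (by omega)
    exact this _ le_rfl
  | succ j ih =>
    classical
    obtain ⟨n, p, hn, hj⟩ := ih
    have hex : ∃ m, n < m ∧ ∃ p, e m = .arrival p := by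
      obtain ⟨m, hm, hlt⟩ := harr.exists_gt n
      exact ⟨m, hlt, hm⟩
    obtain ⟨hlt, q, hq⟩ := Nat.find_spec hex
    refine ⟨_, q, hq, ?_⟩
    have : ∀ m, n + 1 ≤ m → m ≤ Nat.find hex → (after policy e m).numArrived = j + 1 := by
      intro m hnm
      induction m, hnm using Nat.le_induction with
      | base => exact fun _ => by rw [numArrived_after_succ policy hn, hj]
      | succ m hm ih =>
        intro hm'
        rcases hev : e m with q | ⟨q, r⟩
        · exact absurd ⟨by omega, q, hev⟩ (Nat.find_min hex (m := m) (by omega))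
        · simpa [after, hev, step] using ih (by omega)
    exact this _ hlt le_rfl

theorem arrival_unique (policy : BlockGraph → Finset ℕ) {e : ℕ → Event N} {m n : ℕ}
    {p q : Fin N} (hm : e m = .arrival p) (hn : e n = .arrival q)
    (h : (after policy e m).numArrived = (after policy e n).numArrived) : m = n := by
  rcases lt_trichotomy m n with hlt | rfl | hlt
  · have := numArrived_after_mono policy e (Nat.succ_le_of_lt hlt)
    have := numArrived_after_succ policy hm
    simp only [Nat.succ_eq_add_one] at *
    omega
  · rfl
  · have := numArrived_after_mono policy e (Nat.succ_le_of_lt hlt)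
    have := numArrived_after_succ policy hn
    simp only [Nat.succ_eq_add_one] at *
    omega

end Config

/-! ### From synchronization times to the limiting graph -/

variable {N : ℕ} {H : SimpleGraph (Fin N)} {τ : ℕ → ℝ≥0} {e : ℕ → Event N}

theorem configAt_time (policy : BlockGraph → Finset ℕ) (hτ : StrictMono τ) (n : ℕ) :
    configAt policy τ e (τ n) = Config.after policy e (n + 1) := by
  have : {i | τ i ≤ τ n} = ↑(Finset.range (n + 1)) := by
    ext i
    simp [hτ.le_iff_le]
  rw [configAt, this, Set.ncard_coe_finset, Finset.card_range]

theorem limitGraph_adj (policy : BlockGraph → Finset ℕ) (hτ : StrictMono τ) (j k : ℕ) :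
    (limitGraph policy τ e).Adj j k ↔
      ∃ n p, ((Config.after policy e n).peerGraph p).Adj j k := by
  constructor
  · rintro ⟨t, s, p, h⟩
    exact ⟨_, p, h⟩
  · rintro ⟨n, p, h⟩
    cases n with
    | zero => exact absurd h.2.2 (by simp [Config.after, Config.init])
    | succ n =>
      refine ⟨τ n, ⟨τ n, Set.self_mem_Iic⟩, p, ?_⟩
      simpa only [configAt_time policy hτ] using h

/-- If at arbitrarily late times all blocks are known to all peers, then the limiting graph of the
tree policy is one-ended. -/
theorem oneEnded_of_frequently_backlog_nil (hr : IsRealization H τ e)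
    (hb : ∀ T : ℝ≥0, ∃ t ≥ T, (configAt treePolicy τ e t).backlog = []) :
    (limitGraph treePolicy τ e).OneEnded := by
  choose n p he hn using Config.exists_arrival treePolicy hr.arrivals
  -- Block `j + 1` arrives in event `n j` at peer `p j`; `par` and `K` record its reference and what
  -- its miner knew just before.
  let par : ℕ → ℕ
    | 0 => 0
    | j + 1 => sInf ((Config.after treePolicy e (n j)).peerGraph (p j)).farthest
  let K : ℕ → Finset ℕ
    | 0 => ∅
    | j + 1 => (Config.after treePolicy e (n j)).known (p j)
  have htree : ∀ m, (Config.after treePolicy e m).IsTree par := by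
    refine Config.IsTree.after (p 0) fun m q hm => ?_
    have hmn := Config.arrival_unique treePolicy hm
      (he (Config.after treePolicy e m).numArrived) (hn _).symm
    have hq : q = p (Config.after treePolicy e m).numArrived := by
      have := he (Config.after treePolicy e m).numArrived
      rw [← hmn, hm] at this
      exact Event.arrival.inj this
    show sInf ((Config.after treePolicy e (n _)).peerGraph (p _)).farthest = _
    rw [← hmn, ← hq]
  have hlt : ∀ j, j ≠ 0 → par j < j := by
    intro j hj
    obtain ⟨j, rfl⟩ := Nat.exists_eq_succ_of_ne_zero hj
    have := (htree _).le_numArrived _ _ ((htree (n j)).sInf_farthest_mem (p j))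
    rw [hn] at this
    exact Nat.lt_succ_of_le this
  have hsync : ∀ M, ∃ m ≥ M, ∀ j > m, Finset.range (m + 1) ⊆ K j := by
    intro M
    obtain ⟨t, ht, hbt⟩ := hb (τ (n M))
    rw [configAt] at hbt
    set i := {k | τ k ≤ t}.ncard with hi
    have hni : n M ≤ i := by
      -- Finiteness matters here, since `ncard` of an infinite set is `0`.
      have hfin : {k | τ k ≤ t}.Finite := by
        obtain ⟨k₀, hk₀⟩ := (hr.tendsto.eventually_gt_atTop t).exists
        refine (Set.finite_Iio k₀).subset fun k hk => ?_
        exact hr.strictMono.lt_iff_lt.1 (lt_of_le_of_lt hk hk₀)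
      have hsub : (↑(Finset.range (n M)) : Set ℕ) ⊆ {k | τ k ≤ t} := fun k hk =>
        (hr.strictMono.monotone (Finset.mem_range.1 (Finset.mem_coe.1 hk)).le).trans ht
      have := Set.ncard_le_ncard hsub hfin
      rwa [Set.ncard_coe_finset, Finset.card_range] at this
    refine ⟨(Config.after treePolicy e i).numArrived, ?_, fun j hj => ?_⟩
    · have := Config.numArrived_after_mono treePolicy e hni
      simpa only [hn] using this
    · obtain ⟨j, rfl⟩ := Nat.exists_eq_succ_of_ne_zero (Nat.ne_zero_of_lt hj)
      refine ((htree i).range_subset_of_backlog hbt (p j)).trans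
        (Config.known_after_mono treePolicy e (p j) ?_)
      -- If block `j + 1` had arrived before the synchronization, it would be among the blocks
      -- counted by `m`.
      by_contra hlt'
      have h1 := Config.numArrived_after_mono treePolicy e (Nat.succ_le_of_lt (not_le.1 hlt'))
      have h2 := Config.numArrived_after_succ treePolicy (he j)
      simp only [Nat.succ_eq_add_one, hn] at h1 h2 hj
      omega
  refine oneEnded_of_frequently_cut hlt rfl (fun j k => ?_)
    (frequently_cut_of_known hlt rfl (K := K) ?_ ?_ hsync)
  · rw [limitGraph_adj treePolicy hr.strictMono]
    simp only [(htree _).peerGraph_adj]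
    constructor
    · rintro ⟨-, -, -, h⟩
      exact h
    · intro h
      obtain ⟨i, hi⟩ : ∃ i, j ≤ (Config.after treePolicy e i).numArrived := ⟨n j, (hn j).ge⟩
      obtain ⟨q, hq⟩ := (htree i).exists_mem j hi
      exact ⟨i, q, hq, h⟩
  · intro j hj
    obtain ⟨j, rfl⟩ := Nat.exists_eq_succ_of_ne_zero hj
    intro i hi
    have := (htree _).le_numArrived _ _ hi
    rw [hn] at this
    exact Finset.mem_range.2 (Nat.lt_succ_of_le this)
  · intro j hj
    obtain ⟨j, rfl⟩ := Nat.exists_eq_succ_of_ne_zero hj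
    show sInf _ = sInf _
    rw [(htree _).farthest_eq]

/-! ### Recurrence of Markov processes with right-continuous paths -/

section Recurrence

variable {S Ω : Type*} [MeasurableSpace S]

/-- The σ-algebra generated by the values of `X` up to time `s`. -/
abbrev past (X : ℝ≥0 → Ω → S) (s : ℝ≥0) : MeasurableSpace Ω :=
  ⨆ u : Set.Iic s, MeasurableSpace.comap (X u) inferInstance

theorem measurableSet_past [DiscreteMeasurableSpace S] (X : ℝ≥0 → Ω → S) {u s : ℝ≥0}
    (hu : u ≤ s) (B : Set S) : MeasurableSet[past X s] {ω | X u ω ∈ B} := by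
  have h : MeasurableSpace.comap (X u) inferInstance ≤ past X s :=
    le_iSup (fun u : Set.Iic s => MeasurableSpace.comap (X u) inferInstance) ⟨u, hu⟩
  exact h _ ⟨B, .of_discrete, rfl⟩

theorem past_mono (X : ℝ≥0 → Ω → S) {s t : ℝ≥0} (h : s ≤ t) : past X s ≤ past X t :=
  iSup_le fun u => le_iSup (fun u : Set.Iic t => MeasurableSpace.comap (X u) inferInstance)
    ⟨u, u.2.trans h⟩

variable [MeasurableSpace Ω] {P : Kernel S Ω} {X : ℝ≥0 → Ω → S}

theorem IsMarkovProcess.past_le (hX : IsMarkovProcess P X) (s : ℝ≥0) :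
    past X s ≤ ‹MeasurableSpace Ω› :=
  iSup_le fun u => (hX.measurable u).comap_le

theorem IsMarkovProcess.markov_of_subset (hX : IsMarkovProcess P X) (x y z : S) (s t : ℝ≥0)
    {A : Set Ω} (hA : MeasurableSet[past X s] A) (hAy : ∀ ω ∈ A, X s ω = y) :
    P x (A ∩ {ω | X (s + t) ω = z}) = P x A * P y {ω | X t ω = z} := by
  rw [hX.markov x s t z A hA, setLIntegral_congr_fun (g := fun _ => P y {ω | X t ω = z})
    (hX.past_le s _ hA) fun ω hω => by simp only [hAy ω hω], setLIntegral_const, mul_comm]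

variable [DiscreteMeasurableSpace S]

/-- Induction on the largest time: the one-time Markov property is applied at the previous time `k`,
both to the shifted process and to the process started at `y`. -/
theorem IsMarkovProcess.markov_finset (hX : IsMarkovProcess P X) [IsMarkovKernel P] (x y : S)
    (s : ℝ≥0) {A : Set Ω} (hA : MeasurableSet[past X s] A) (hAy : ∀ ω ∈ A, X s ω = y)
    (w : ℝ≥0 → S) (I : Finset ℝ≥0) :
    P x (A ∩ {ω | ∀ u ∈ I, X (s + u) ω = w u}) = P x A * P y {ω | ∀ u ∈ I, X u ω = w u} := by
  induction I using Finset.induction_on_max with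
  | empty => simp
  | insert m J hm ih =>
    rcases J.eq_empty_or_nonempty with rfl | hJ
    · simpa using hX.markov_of_subset x y (w m) s m hA hAy
    · have hk := J.max'_mem hJ
      set k := J.max' hJ
      have hkm : k + (m - k) = m := add_tsub_cancel_of_le (hm k hk).le
      have hle : ∀ u ∈ J, u ≤ k := fun u hu => J.le_max' u hu
      have hmeas : ∀ v r, v + k ≤ r →
          MeasurableSet[past X r] {ω | ∀ u ∈ J, X (v + u) ω = w u} := by
        intro v r hr
        have : {ω | ∀ u ∈ J, X (v + u) ω = w u} = ⋂ u ∈ J, {ω | X (v + u) ω ∈ ({w u} : Set S)} := by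
          ext; simp
        rw [this]
        exact J.measurableSet_biInter fun u hu =>
          measurableSet_past X (le_trans (by gcongr; exact hle u hu) hr) _
      have hmeas0 : MeasurableSet[past X k] {ω | ∀ u ∈ J, X u ω = w u} := by
        have h := hmeas 0 k (zero_add k).le
        simp only [zero_add] at h
        exact h
      have h1 := hX.markov_of_subset x (w k) (w m) (s + k) (m - k)
        (A := A ∩ {ω | ∀ u ∈ J, X (s + u) ω = w u})
        (MeasurableSet.inter (past_mono X le_self_add _ hA) (hmeas s _ le_rfl)) fun ω hω => hω.2 k hk
      have h2 := hX.markov_of_subset y (w k) (w m) k (m - k) hmeas0 fun ω hω => hω k hk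
      rw [add_assoc, hkm] at h1
      rw [hkm] at h2
      have e1 : A ∩ {ω | ∀ u ∈ insert m J, X (s + u) ω = w u} =
          (A ∩ {ω | ∀ u ∈ J, X (s + u) ω = w u}) ∩ {ω | X (s + m) ω = w m} := by
        ext ω
        simp only [Finset.forall_mem_insert, Set.mem_inter_iff, Set.mem_ofPred_eq]
        tauto
      have e2 : {ω | ∀ u ∈ insert m J, X u ω = w u} =
          {ω | ∀ u ∈ J, X u ω = w u} ∩ {ω | X m ω = w m} := by
        ext ω
        simp only [Finset.forall_mem_insert, Set.mem_inter_iff, Set.mem_ofPred_eq]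
        tauto
      rw [e1, e2, h1, h2, ih, mul_assoc]

/-- The Markov property for events that depend on the whole path after time `s`. -/
theorem IsMarkovProcess.markov_path [Countable S] (hX : IsMarkovProcess P X) [IsMarkovKernel P] (x y : S)
    (s : ℝ≥0) {A : Set Ω} (hA : MeasurableSet[past X s] A) (hAy : ∀ ω ∈ A, X s ω = y)
    {C : Set (ℝ≥0 → S)} (hC : MeasurableSet C) :
    P x (A ∩ {ω | (fun u => X (s + u) ω) ∈ C}) =
      P x A * P y {ω | (fun u => X u ω) ∈ C} := by
  have hA' := hX.past_le s _ hA
  have hs : Measurable fun ω u => X (s + u) ω := measurable_pi_lambda _ fun u => hX.measurable _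
  have h0 : Measurable fun ω u => X u ω := measurable_pi_lambda _ fun u => hX.measurable _
  let μ₁ : Measure (ℝ≥0 → S) := ((P x).restrict A).map fun ω u => X (s + u) ω
  let μ₂ : Measure (ℝ≥0 → S) := P x A • (P y).map fun ω u => X u ω
  have hfin : IsFiniteMeasure μ₂ := by
    refine ⟨?_⟩
    simp only [μ₂, Measure.smul_apply, smul_eq_mul]
    exact ENNReal.mul_lt_top (measure_lt_top _ _) (measure_lt_top _ _)
  -- Finite measures on path space are determined by their finite-dimensional marginals, which need
  -- only be compared on singletons because `S` is countable.
  have key : μ₁ = μ₂ := by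
    refine IsProjectiveLimit.unique (P := fun I => μ₂.map I.restrict) (fun I => ?_) fun I => rfl
    refine Measure.ext_of_singleton fun w => ?_
    have hI : Measurable (I.restrict (π := fun _ : ℝ≥0 => S)) := Finset.measurable_restrict I
    let w' : ℝ≥0 → S := fun u => if h : u ∈ I then w ⟨u, h⟩ else y
    have hw : ∀ v : ℝ≥0 → S, I.restrict v = w ↔ ∀ u ∈ I, v u = w' u := by
      intro v
      rw [funext_iff]
      constructor
      · intro h u hu
        simpa [w', hu] using h ⟨u, hu⟩
      · rintro h ⟨u, hu⟩
        simpa [w', hu] using h u hu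
    have hpre := hI (measurableSet_singleton w)
    rw [Measure.map_apply hI (measurableSet_singleton w),
      Measure.map_apply hI (measurableSet_singleton w)]
    simp only [μ₁, μ₂, Measure.smul_apply, smul_eq_mul]
    rw [Measure.map_apply hs hpre, Measure.map_apply h0 hpre, Measure.restrict_apply (hs hpre)]
    have e1 : (fun ω u => X (s + u) ω) ⁻¹' (I.restrict ⁻¹' {w}) =
        {ω | ∀ u ∈ I, X (s + u) ω = w' u} := by
      ext ω
      exact hw _
    have e2 : (fun ω u => X u ω) ⁻¹' (I.restrict ⁻¹' {w}) = {ω | ∀ u ∈ I, X u ω = w' u} := by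
      ext ω
      exact hw _
    rw [e1, e2, Set.inter_comm]
    exact hX.markov_finset x y s hA hAy w' I
  have := congrArg (fun μ => μ C) key
  simp only [μ₁, μ₂, Measure.smul_apply, smul_eq_mul] at this
  rw [Measure.map_apply hs hC, Measure.map_apply h0 hC, Measure.restrict_apply (hs hC),
    Set.inter_comm] at this
  exact this

end Recurrence

/-! ### Deterministic properties of right-continuous paths -/

section Paths

variable {S : Type*}

/-- Right-continuity of a path for the discrete topology. -/
def IsRightConst (w : ℝ≥0 → S) : Prop := ∀ t, ∀ᶠ u in 𝓝[≥] t, w u = w t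

theorem IsRightConst.exists_forall_eq {w : ℝ≥0 → S} (hw : IsRightConst w) {t b : ℝ≥0}
    (hb : t < b) : ∃ u, t < u ∧ u ≤ b ∧ ∀ v, t ≤ v → v < u → w v = w t := by
  obtain ⟨u, hu, hsub⟩ := mem_nhdsGE_iff_exists_Ico_subset.1 (hw t)
  exact ⟨min u b, lt_min hu hb, min_le_right _ _, fun v h1 h2 =>
    hsub ⟨h1, h2.trans_le (min_le_left _ _)⟩⟩

/-- A countable dense sequence of times. -/
noncomputable abbrev denseTime : ℕ → ℝ≥0 := TopologicalSpace.denseSeq ℝ≥0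

theorem exists_denseTime_between {a b : ℝ≥0} (h : a < b) :
    ∃ n, a < denseTime n ∧ denseTime n < b := by
  obtain ⟨_, ⟨n, rfl⟩, h⟩ := (TopologicalSpace.denseRange_denseSeq ℝ≥0).exists_between h
  exact ⟨n, h⟩

theorem IsRightConst.exists_denseTime {w : ℝ≥0 → S} (hw : IsRightConst w) {t b : ℝ≥0}
    (hb : t < b) : ∃ n, t < denseTime n ∧ denseTime n < b ∧ w (denseTime n) = w t := by
  obtain ⟨u, h1, h2, h3⟩ := hw.exists_forall_eq hb
  obtain ⟨n, hn1, hn2⟩ := exists_denseTime_between h1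
  exact ⟨n, hn1, hn2.trans_le h2, h3 _ hn1.le hn2⟩

/-- Paths that are in `x` at all times of the dense sequence before `δ`. -/
def stays (x : S) (δ : ℝ≥0) : Set (ℝ≥0 → S) := {w | ∀ n, denseTime n < δ → w (denseTime n) = x}

/-- Paths that are never, at times of the dense sequence, outside `x` first and in `x` later. -/
def noReturn (x : S) : Set (ℝ≥0 → S) :=
  {w | ∀ m n, denseTime m < denseTime n → w (denseTime n) = x → w (denseTime m) = x}

theorem IsRightConst.eq_of_mem_stays {w : ℝ≥0 → S} (hw : IsRightConst w) {x : S} {δ : ℝ≥0}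
    (h : w ∈ stays x δ) {t : ℝ≥0} (ht : t < δ) : w t = x := by
  obtain ⟨n, -, h2, h3⟩ := hw.exists_denseTime ht
  rw [← h3, h n h2]

theorem IsRightConst.eq_of_mem_noReturn {w : ℝ≥0 → S} (hw : IsRightConst w) {x : S}
    (h : w ∈ noReturn x) {s t : ℝ≥0} (hst : s < t) (ht : w t = x) : w s = x := by
  obtain ⟨m, -, h2, h3⟩ := hw.exists_denseTime hst
  obtain ⟨n, h1', -, h3'⟩ := hw.exists_denseTime (lt_add_one t)
  rw [← h3, h m n (h2.trans h1') (h3'.trans ht)]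

open Classical in
/-- The indices `j` of the times `j * h` in `[a, b)` at which the path, observed at multiples of
`h`, is about to enter `x`. -/
noncomputable def entries (w : ℝ≥0 → S) (x : S) (h a b : ℝ≥0) : Finset ℕ :=
  ((Finset.range ⌈b / h⌉₊).filter fun j : ℕ => a ≤ j * h ∧ j * h < b).filter fun j : ℕ =>
    w (j * h) ≠ x ∧ w ((j + 1 : ℕ) * h) = x

theorem mem_entries {w : ℝ≥0 → S} {x : S} {h a b : ℝ≥0} (hh : 0 < h) {j : ℕ} :
    j ∈ entries w x h a b ↔
      (a ≤ j * h ∧ j * h < b) ∧ w (j * h) ≠ x ∧ w ((j + 1 : ℕ) * h) = x := by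
  have : (j : ℝ≥0) * h < b → j < ⌈b / h⌉₊ := fun hj => Nat.lt_ceil.2 ((lt_div_iff₀ hh).2 hj)
  simp only [entries, Finset.mem_filter, Finset.mem_range]
  tauto

theorem exists_mul_mem_Ico {s u h : ℝ≥0} (hh : 0 < h) (hu : s + h ≤ u) :
    ∃ j : ℕ, s ≤ j * h ∧ j * h < u := by
  refine ⟨⌈s / h⌉₊, (div_le_iff₀ hh).1 (Nat.le_ceil _), lt_of_lt_of_le ?_ hu⟩
  have := mul_lt_mul_of_pos_right (Nat.ceil_lt_add_one (zero_le (a := s / h))) hh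
  rwa [add_mul, div_mul_cancel₀ _ hh.ne', one_mul] at this

theorem exists_last_not {p : ℕ → Prop} {i j : ℕ} (hij : i ≤ j) (hi : ¬ p i) (hj : p j) :
    ∃ k, i ≤ k ∧ k < j ∧ ¬ p k ∧ p (k + 1) := by
  induction j, hij using Nat.le_induction with
  | base => exact absurd hj hi
  | succ j hij ih =>
    by_cases h : p j
    · obtain ⟨k, h1, h2, h3⟩ := ih h
      exact ⟨k, h1, by omega, h3⟩
    · exact ⟨j, hij, by omega, h, hj⟩

/-- If entries into `x` accumulate at `L` from the left, then their number on fine grids is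
arbitrarily large. -/
theorem IsRightConst.eventually_le_card_entries {w : ℝ≥0 → S} (hw : IsRightConst w) {x : S}
    {a L : ℝ≥0} (hL : ∀ r, a ≤ r → r < L → ∃ s t, r < s ∧ s < t ∧ t < L ∧ w t = x ∧ w s ≠ x)
    (K : ℕ) (r : ℝ≥0) (har : a ≤ r) (hr : r < L) :
    ∀ᶠ h in 𝓝[>] (0 : ℝ≥0), K ≤ (entries w x h r L).card := by
  induction K generalizing r with
  | zero => simp
  | succ K ih =>
    -- The path avoids `x` on `[s, s')` and is in `x` on `[t, t')`. A fine grid has points in both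
    -- intervals, hence sees an entry starting before `t'`; induction supplies the others in `[t',
    -- L)`.
    obtain ⟨s, t, hrs, hst, htL, hwt, hws⟩ := hL r har hr
    obtain ⟨s', hs, hst', hs'⟩ := hw.exists_forall_eq hst
    obtain ⟨b, htb, hbL⟩ := exists_between htL
    obtain ⟨t', ht, htb', ht'⟩ := hw.exists_forall_eq htb
    have hsmall : ∀ {u v : ℝ≥0}, u < v → ∀ᶠ h in 𝓝[>] (0 : ℝ≥0), u + h ≤ v := by
      intro u v huv
      filter_upwards [nhdsWithin_le_nhds (eventually_le_nhds (tsub_pos_of_lt huv))] with h hh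
      rw [add_comm]
      exact add_le_of_le_tsub_right_of_le huv.le hh
    filter_upwards [ih t' (har.trans (hrs.trans (hst.trans ht)).le) (htb'.trans_lt hbL),
      hsmall hs, hsmall ht, self_mem_nhdsWithin] with h h1 h2 h3 hpos
    have hpos : 0 < h := hpos
    obtain ⟨i, hi1, hi2⟩ := exists_mul_mem_Ico hpos h2
    obtain ⟨j, hj1, hj2⟩ := exists_mul_mem_Ico hpos h3
    have hij : i ≤ j := by
      have : (i : ℝ≥0) < j := lt_of_mul_lt_mul_right (hi2.trans_le (hst'.trans hj1)) hpos.le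
      exact_mod_cast this.le
    obtain ⟨k, hk1, hk2, hk3, hk4⟩ := exists_last_not (p := fun j : ℕ => w (j * h) = x) hij
      (by rw [hs' _ hi1 hi2]; exact hws) (by rw [ht' _ hj1 hj2]; exact hwt)
    have hik : (i : ℝ≥0) * h ≤ k * h := by gcongr
    have hkj : (k : ℝ≥0) * h < t' := lt_of_le_of_lt (by gcongr) hj2
    have hk : k ∉ entries w x h t' L := fun hmem =>
      hkj.not_ge ((mem_entries hpos).1 hmem).1.1
    refine (Nat.succ_le_succ h1).trans ((Finset.card_insert_of_notMem hk).ge.trans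
      (Finset.card_le_card (Finset.insert_subset ?_ fun l hl => ?_)))
    · exact (mem_entries hpos).2
        ⟨⟨hrs.le.trans (hi1.trans hik), hkj.trans (htb'.trans_lt hbL)⟩, hk3, hk4⟩
    · obtain ⟨⟨hl1, hl2⟩, hl3⟩ := (mem_entries hpos).1 hl
      exact (mem_entries hpos).2 ⟨⟨(hrs.trans (hst.trans ht)).le.trans hl1, hl2⟩, hl3⟩

/-- A path that always comes back to `x`, without accumulation of the entries into `x`, is in `x`
at arbitrarily late times. -/
theorem IsRightConst.frequently_eq {w : ℝ≥0 → S} (hw : IsRightConst w) {x : S} (h0 : w 0 = x)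
    (hacc : ∀ L > 0, ∃ r < L, ∀ s t, r < s → s < t → t < L → w t = x → w s = x)
    (hret : ∀ n, w (denseTime n) = x → (fun u => w (denseTime n + u)) ∉ noReturn x) (T : ℝ≥0) :
    ∃ t ≥ T, w t = x := by
  by_contra! hT
  have hbdd : BddAbove {t | w t = x} := ⟨T, fun t ht => by
    by_contra hlt
    exact hT t (not_le.1 hlt).le ht⟩
  have hne : {t | w t = x}.Nonempty := ⟨0, h0⟩
  set L := sSup {t | w t = x}
  have hle : ∀ t, w t = x → t ≤ L := fun t ht => le_csSup hbdd ht
  -- Otherwise right-continuity would give visits after the supremum `L`.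
  have hwL : w L ≠ x := by
    intro h
    obtain ⟨n, h1, -, h3⟩ := hw.exists_denseTime (lt_add_one L)
    exact h1.not_ge (hle _ (h3.trans h))
  have hlt : ∀ t, w t = x → t < L := fun t ht => (hle t ht).lt_of_ne (by rintro rfl; exact hwL ht)
  obtain ⟨r, hrL, hr⟩ := hacc L (hlt 0 h0 |>.trans_le' zero_le)
  obtain ⟨v, hv, hrv⟩ := exists_lt_of_lt_csSup hne hrL
  obtain ⟨n, h1, -, h3⟩ := hw.exists_denseTime (hlt v hv)
  have := hret n (h3.trans hv)
  simp only [noReturn, Set.mem_ofPred_eq, not_forall] at this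
  obtain ⟨k, l, hkl, hl, hk⟩ := this
  exact hk (hr _ _ (hrv.trans (h1.trans_le le_self_add)) (by gcongr) (hlt _ hl) hl)

variable [MeasurableSpace S] [DiscreteMeasurableSpace S]

theorem measurableSet_apply_eq (t : ℝ≥0) (x : S) :
    MeasurableSet {w : ℝ≥0 → S | w t = x} := by
  have ht : Measurable fun w : ℝ≥0 → S => w t := measurable_pi_apply t
  exact ht (MeasurableSet.of_discrete (s := {x}))

theorem measurableSet_stays (x : S) (δ : ℝ≥0) : MeasurableSet (stays x δ) := by
  have : stays x δ = ⋂ n, {w | denseTime n < δ → w (denseTime n) = x} := by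
    ext; simp [stays]
  rw [this]
  refine .iInter fun n => ?_
  by_cases h : denseTime n < δ
  · simpa [h] using measurableSet_apply_eq (denseTime n) x
  · simp [h]

theorem measurableSet_noReturn (x : S) : MeasurableSet (noReturn x) := by
  have : noReturn x = ⋂ m, ⋂ n, {w | denseTime m < denseTime n →
      w (denseTime n) = x → w (denseTime m) = x} := by
    ext; simp [noReturn]
  rw [this]
  refine .iInter fun m => .iInter fun n => ?_
  by_cases h : denseTime m < denseTime n
  · simp only [h, true_imp_iff]
    exact (measurableSet_apply_eq _ x).imp (measurableSet_apply_eq _ x)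
  · simp [h]

/-- Paths that are in their initial state at arbitrarily late times. -/
def recurrentPaths : Set (ℝ≥0 → S) := {w | ∀ k : ℕ, ∃ n, k ≤ denseTime n ∧ w (denseTime n) = w 0}

theorem measurableSet_recurrentPaths [Countable S] :
    MeasurableSet (recurrentPaths (S := S)) := by
  have : recurrentPaths (S := S) =
      ⋂ k : ℕ, ⋃ n, {w | k ≤ denseTime n ∧ w (denseTime n) = w 0} := by
    ext; simp [recurrentPaths]
  rw [this]
  refine .iInter fun k => .iUnion fun n => ?_
  by_cases h : (k : ℝ≥0) ≤ denseTime n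
  · simpa only [h, true_and] using
      measurableSet_eq_fun (measurable_pi_apply (denseTime n)) (measurable_pi_apply 0)
  · simp [h]

end Paths

/-! ### Almost sure recurrence from finite mean return times -/

section Recurrence

variable {S Ω : Type*} [MeasurableSpace S] [MeasurableSpace Ω]
  {P : Kernel S Ω} {X : ℝ≥0 → Ω → S}

theorem IsMarkovProcess.isRightConst (hX : IsMarkovProcess P X) (ω : Ω) :
    IsRightConst fun u => X u ω :=
  fun t => hX.rightContinuous ω t

theorem IsMarkovProcess.measurable_path (hX : IsMarkovProcess P X) :
    Measurable fun ω u => X u ω :=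
  measurable_pi_lambda _ fun _ => hX.measurable _

theorem IsMarkovProcess.measurable_shift (hX : IsMarkovProcess P X) (s : ℝ≥0) :
    Measurable fun ω u => X (s + u) ω :=
  measurable_pi_lambda _ fun _ => hX.measurable _

/-- By right-continuity every path from `x` stays there for some time `1 / (n + 1)`; countably many
null events could not cover this. -/
theorem IsMarkovProcess.exists_stays_ne_zero (hX : IsMarkovProcess P X) [IsMarkovKernel P]
    (x : S) : ∃ δ > 0, P x {ω | (fun u => X u ω) ∈ stays x δ} ≠ 0 := by
  by_contra! h
  have h1 : ∀ᵐ ω ∂(P x), ∀ n : ℕ, (fun u => X u ω) ∉ stays x (1 / ((n : ℝ≥0) + 1)) := by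
    refine ae_all_iff.2 fun n => ?_
    have := h (1 / ((n : ℝ≥0) + 1)) (by positivity)
    rw [ae_iff]
    simpa using this
  obtain ⟨ω, hω, h0⟩ := (h1.and (hX.initial x)).exists
  obtain ⟨u, hu, -, hu'⟩ := (hX.isRightConst ω).exists_forall_eq (zero_lt_one (α := ℝ≥0))
  obtain ⟨n, hn⟩ := exists_nat_one_div_lt (K := ℝ≥0) hu
  exact hω n fun k hk => (hu' _ zero_le (hk.trans hn)).trans h0

variable [DiscreteMeasurableSpace S]

/-- On `noReturn x` the return time is an infimum over the empty set, hence `∞`; positive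
probability would make its mean infinite. -/
theorem IsMarkovProcess.measure_noReturn_eq_zero (hX : IsMarkovProcess P X) {x : S}
    (hx : ∫⁻ ω, returnTime X x ω ∂(P x) < ∞) :
    P x {ω | (fun u => X u ω) ∈ noReturn x} = 0 := by
  by_contra h0
  have hm : MeasurableSet {ω | (fun u => X u ω) ∈ noReturn x} :=
    hX.measurable_path (measurableSet_noReturn x)
  refine hx.not_ge ?_
  calc ∞ = ∞ * P x {ω | (fun u => X u ω) ∈ noReturn x} := (ENNReal.top_mul h0).symm
    _ = ∫⁻ ω in {ω | (fun u => X u ω) ∈ noReturn x}, ∞ ∂(P x) := (setLIntegral_const _ _).symm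
    _ ≤ ∫⁻ ω in {ω | (fun u => X u ω) ∈ noReturn x}, returnTime X x ω ∂(P x) := by
      refine setLIntegral_mono' hm fun ω hω => ?_
      refine le_iInf₂ fun t ht => ?_
      obtain ⟨ht, s, hst, hs⟩ := ht
      exact absurd ((hX.isRightConst ω).eq_of_mem_noReturn hω hst ht) hs
    _ ≤ ∫⁻ ω, returnTime X x ω ∂(P x) := setLIntegral_le_lintegral _ _

theorem measurable_card_entries (hX : ∀ t, Measurable (X t)) (x : S) (h a b : ℝ≥0) :
    Measurable fun ω => ((entries (fun u => X u ω) x h a b).card : ℝ≥0∞) := by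
  classical
  simp only [entries, Finset.card_filter]
  push_cast
  refine Finset.measurable_sum _ fun j _ => Measurable.ite ?_ measurable_const measurable_const
  exact (hX _ (MeasurableSet.of_discrete (s := {x}ᶜ))).inter
    (hX _ (MeasurableSet.of_discrete (s := {x})))

variable [Countable S]

/-- In a window shorter than a typical stay in `x`, at most one entry into `x` is followed by
such a stay; this bounds the mean number of entries uniformly in the mesh of the grid. -/
theorem IsMarkovProcess.lintegral_card_entries_mul_le (hX : IsMarkovProcess P X)
    [IsMarkovKernel P] (x : S) {h δ : ℝ≥0} (a : ℝ≥0) :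
    (∫⁻ ω, (entries (fun u => X u ω) x h a (a + δ)).card ∂(P x)) *
      P x {ω | (fun u => X u ω) ∈ stays x δ} ≤ 1 := by
  classical
  set J := (Finset.range ⌈(a + δ) / h⌉₊).filter fun j : ℕ => a ≤ j * h ∧ j * h < a + δ with hJ
  let E : ℕ → Set Ω := fun j => {ω | X (j * h) ω ≠ x ∧ X ((j + 1 : ℕ) * h) ω = x}
  have hE : ∀ j, MeasurableSet[past X ((j + 1 : ℕ) * h)] (E j) := fun j =>
    MeasurableSet.inter (measurableSet_past X (by gcongr; omega) {x}ᶜ)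
      (measurableSet_past X le_rfl {x})
  have hE' : ∀ j, MeasurableSet (E j) := fun j => hX.past_le _ _ (hE j)
  have hcard : ∀ ω, ((entries (fun u => X u ω) x h a (a + δ)).card : ℝ≥0∞) =
      ∑ j ∈ J, (E j).indicator 1 ω := by
    intro ω
    rw [entries, Finset.card_filter]
    push_cast
    refine Finset.sum_congr (by rw [hJ]) fun j _ => ?_
    simp only [Set.indicator_apply, Pi.one_apply, E, Set.mem_ofPred_eq, Nat.cast_add,
      Nat.cast_one]
  have hsum : ∫⁻ ω, (entries (fun u => X u ω) x h a (a + δ)).card ∂(P x) =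
      ∑ j ∈ J, P x (E j) := by
    simp only [hcard]
    rw [lintegral_finsetSum _ fun j _ => measurable_one.indicator (hE' j)]
    exact Finset.sum_congr rfl fun j _ => lintegral_indicator_one (hE' j)
  let T : ℕ → Set Ω := fun j =>
    E j ∩ {ω | (fun u => X ((j + 1 : ℕ) * h + u) ω) ∈ stays x δ}
  have hT : ∀ j, MeasurableSet (T j) := fun j =>
    (hE' j).inter (hX.measurable_shift _ (measurableSet_stays x δ))
  have hTE : ∀ j, P x (T j) = P x (E j) * P x {ω | (fun u => X u ω) ∈ stays x δ} := fun j =>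
    hX.markov_path x x _ (hE j) (fun ω hω => hω.2) (measurableSet_stays x δ)
  -- The stay after entry `i` covers `[(i + 1) * h, (i + 1) * h + δ)`. This contains `j * h`, where
  -- entry `j` requires the path to be outside `x`.
  have hlt : ∀ i ∈ J, ∀ j ∈ J, i < j → ∀ ω, ω ∈ T i → ω ∉ T j := by
    intro i hi j hj hij ω hωi hωj
    rw [hJ, Finset.mem_filter] at hi hj
    have hle : ((i + 1 : ℕ) : ℝ≥0) * h ≤ j * h := by gcongr; omega
    obtain ⟨u, hu⟩ := exists_add_of_le hle
    have huδ : u < δ := by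
      have h1 : (i : ℝ≥0) * h ≤ (i + 1 : ℕ) * h := by gcongr; omega
      have h2 : ((i + 1 : ℕ) : ℝ≥0) * h + u < (i + 1 : ℕ) * h + δ := by
        rw [← hu]
        exact hj.2.2.trans_le (by gcongr; exact hi.2.1.trans h1)
      exact lt_of_add_lt_add_left h2
    have hrc : IsRightConst fun u => X ((i + 1 : ℕ) * h + u) ω := by
      intro t
      have ht : Tendsto (fun u => ((i + 1 : ℕ) : ℝ≥0) * h + u) (𝓝[≥] t)
          (𝓝[≥] (((i + 1 : ℕ) : ℝ≥0) * h + t)) := by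
        refine tendsto_nhdsWithin_iff.2 ⟨?_, ?_⟩
        · exact ((continuous_const.add continuous_id).tendsto t).mono_left nhdsWithin_le_nhds
        · filter_upwards [self_mem_nhdsWithin] with u hu
          exact add_le_add le_rfl (Set.mem_Ici.1 hu)
      exact ht.eventually (hX.rightContinuous ω _)
    have := hrc.eq_of_mem_stays hωi.2 huδ
    simp only [← hu] at this
    exact hωj.1.1 this
  rw [hsum, Finset.sum_mul, ← Finset.sum_congr rfl fun j _ => hTE j,
    ← measure_biUnion_finset ?_ fun j _ => hT j]
  · exact prob_le_one
  · intro i hi j hj hne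
    refine Set.disjoint_left.2 fun ω hωi hωj => ?_
    rcases hne.lt_or_gt with hij | hij
    · exact hlt i hi j hj hij ω hωi hωj
    · exact hlt j hj i hi hij ω hωj hωi

/-- Almost surely, entries into the initial state do not accumulate. -/
theorem IsMarkovProcess.ae_no_accumulation (hX : IsMarkovProcess P X) [IsMarkovKernel P]
    (x : S) : ∀ᵐ ω ∂(P x), ∀ L > 0, ∃ r < L, ∀ s t, r < s → s < t → t < L →
      X t ω = x → X s ω = x := by
  obtain ⟨δ, hδ, hc⟩ := hX.exists_stays_ne_zero x
  let g : ℕ → ℝ≥0 := fun k => 1 / ((k : ℝ≥0) + 1)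
  have hg : Tendsto g atTop (𝓝[>] 0) :=
    tendsto_nhdsWithin_iff.2 ⟨tendsto_one_div_add_atTop_nhds_zero_nat,
      .of_forall fun k => by simp only [g, Set.mem_Ioi]; positivity⟩
  have hfin : ∀ᵐ ω ∂(P x), ∀ i : ℕ, liminf (fun k =>
      ((entries (fun u => X u ω) x (g k) (i * δ) (i * δ + δ)).card : ℝ≥0∞)) atTop < ∞ := by
    refine ae_all_iff.2 fun i => ?_
    have hm := fun k => measurable_card_entries hX.measurable x (g k) (i * δ) (i * δ + δ)
    refine ae_lt_top (.liminf hm) (ne_top_of_le_ne_top ?_ (lintegral_liminf_le hm))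
    refine ne_top_of_le_ne_top (ENNReal.inv_ne_top.2 hc) (liminf_le_of_le (by isBoundedDefault) ?_)
    intro b hb
    obtain ⟨k, hk⟩ := hb.exists
    exact hk.trans (ENNReal.le_inv_iff_mul_le.2 (hX.lintegral_card_entries_mul_le x _))
  filter_upwards [hfin] with ω hω L hL
  -- The index `i = ⌈L / δ⌉₊ - 1` gives `i * δ < L ≤ i * δ + δ`, so the window starts strictly
  -- before `L` and catches entries accumulating from the left.
  obtain ⟨i, hi⟩ := Nat.exists_eq_succ_of_ne_zero (Nat.ceil_pos.2 (div_pos hL hδ)).ne'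
  have hiL : i * δ < L := by
    rw [← lt_div_iff₀ hδ]
    exact Nat.lt_ceil.1 (by omega)
  have hLi : L ≤ i * δ + δ := by
    have := Nat.le_ceil (L / δ)
    rw [hi, div_le_iff₀ hδ] at this
    simpa [add_mul] using this
  by_contra! hacc
  refine (hω i).ne (ENNReal.eq_top_of_forall_nnreal_le fun r => ?_)
  obtain ⟨K, hK⟩ := exists_nat_ge r
  refine le_liminf_of_le (by isBoundedDefault) ?_
  have hev := (hX.isRightConst ω).eventually_le_card_entries (x := x) (a := i * δ)
    (fun r _ hr => hacc r hr) K (i * δ) le_rfl hiL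
  filter_upwards [hg.eventually hev, hg.eventually self_mem_nhdsWithin] with k hk hpos
  calc (r : ℝ≥0∞) ≤ (K : ℝ≥0∞) := by exact_mod_cast hK
    _ ≤ _ := Nat.cast_le.2 (hk.trans (Finset.card_le_card fun j hj => ?_))
  obtain ⟨⟨h1, h2⟩, h3⟩ := (mem_entries hpos).1 hj
  exact (mem_entries hpos).2 ⟨⟨h1, h2.trans_le hLi⟩, h3⟩

/-- Almost surely, a positive recurrent process is in its initial state at arbitrarily late
times. -/
theorem PositiveRecurrent.ae_mem_recurrentPaths (hrec : PositiveRecurrent P X)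
    (hX : IsMarkovProcess P X) [IsMarkovKernel P] (x : S) :
    ∀ᵐ ω ∂(P x), (fun u => X u ω) ∈ recurrentPaths := by
  suffices h : ∀ᵐ ω ∂(P x), ∀ T : ℝ≥0, ∃ t ≥ T, X t ω = x by
    filter_upwards [h, hX.initial x] with ω hω h0 k
    obtain ⟨t, ht, hx⟩ := hω k
    obtain ⟨n, h1, -, h3⟩ := (hX.isRightConst ω).exists_denseTime (lt_add_one t)
    exact ⟨n, le_trans ht h1.le, h3.trans (hx.trans h0.symm)⟩
  rcases hrec x with habs | hret
  · filter_upwards [habs] with ω hω T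
    exact ⟨T, le_rfl, hω T⟩
  · have hback : ∀ᵐ ω ∂(P x), ∀ n, X (denseTime n) ω = x →
        (fun u => X (denseTime n + u) ω) ∉ noReturn x := by
      refine ae_all_iff.2 fun n => ?_
      have := hX.markov_path x x (denseTime n) (measurableSet_past X le_rfl {x})
        (fun ω hω => hω) (measurableSet_noReturn x)
      rw [hX.measure_noReturn_eq_zero hret, mul_zero] at this
      filter_upwards [measure_eq_zero_iff_ae_notMem.1 this] with ω hω h1 h2
      exact hω ⟨h1, h2⟩
    filter_upwards [hback, hX.ae_no_accumulation x, hX.initial x] with ω h1 h2 h3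
    exact (hX.isRightConst ω).frequently_eq h3 h2 h1

end Recurrence

end Blockchain

/-! ### The main theorem -/

theorem corollary1 {N : ℕ} (H : SimpleGraph (Fin N))
    {Ω S : Type*} [MeasurableSpace Ω]
    [Countable S] [MeasurableSpace S] [DiscreteMeasurableSpace S]
    -- a positive recurrent Markov process, started from an initial distribution `ν`
    (P : ProbabilityTheory.Kernel S Ω) [ProbabilityTheory.IsMarkovKernel P]
    (X : ℝ≥0 → Ω → S)
    (hX : Blockchain.IsMarkovProcess P X)
    (hrec : Blockchain.PositiveRecurrent P X)
    (ν : MeasureTheory.Measure S) [MeasureTheory.IsProbabilityMeasure ν]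
    -- the random times and marks of the block arrivals and of the contacts between peers
    (τ : Ω → ℕ → ℝ≥0) (e : Ω → ℕ → Blockchain.Event N)
    (hreal : ∀ᵐ ω ∂(ν.bind P), Blockchain.IsRealization H (τ ω) (e ω))
    -- the state of the Markov process determines the dissemination state of the system
    (f : S → List (Finset (Fin N)))
    (hstate : ∀ᵐ ω ∂(ν.bind P), ∀ t,
      (Blockchain.configAt Blockchain.treePolicy (τ ω) (e ω) t).backlog = f (X t ω)) :
    ∀ᵐ ω ∂(ν.bind P),
      (Blockchain.limitGraph Blockchain.treePolicy (τ ω) (e ω)).OneEnded := by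
  open Blockchain in
  -- `recurrentPaths` refers to the initial state through `w 0`, so one measurable event serves all
  -- starting points and can be integrated against `ν`.
  have hmeas : MeasurableSet {ω | (fun u => X u ω) ∈ recurrentPaths} :=
    hX.measurable_path measurableSet_recurrentPaths
  have hrecur : ∀ᵐ ω ∂(ν.bind P), (fun u => X u ω) ∈ recurrentPaths := by
    rw [ae_iff]
    change ν.bind P {ω | (fun u => X u ω) ∈ recurrentPaths}ᶜ = 0
    rw [Measure.bind_apply hmeas.compl P.measurable.aemeasurable]
    simp only [fun x => ae_iff.1 (hrec.ae_mem_recurrentPaths hX x), Set.compl_def,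
      Set.mem_ofPred_eq, lintegral_zero]
  filter_upwards [hreal, hstate, hrecur] with ω hr hs hω
  refine oneEnded_of_frequently_backlog_nil hr fun T => ?_
  obtain ⟨k, hk⟩ := exists_nat_ge T
  obtain ⟨n, hn, heq⟩ := hω k
  refine ⟨denseTime n, hk.trans hn, ?_⟩
  -- Event times are positive, so the configuration at time `0` is the initial one.
  have h0 : {i | τ ω i ≤ 0} = ∅ :=
    Set.eq_empty_of_forall_notMem fun i hi => (hr.pos i).not_ge hi
  rw [hs, show X (denseTime n) ω = X 0 ω from heq, ← hs, configAt, h0, Set.ncard_empty]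
  exact Config.backlog_init N
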